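/- Let $0\le\varepsilon<\tfrac12$ be fixed. For each $n$ consider $n$ women and $n$ men; every woman has a preference list that is a total ordering of all the men, and every man has one that is a total ordering of all the women. A perfect marriage is a bijection $\mu$ from the women to the men; it is stable if there is no pair $(w,m)$ such that each of $w$ and $m$ prefers the other over their spouse in $\mu$. The divorce distance between perfect marriages $\mu,\mu'$ is $d(\mu,\mu')=n-|\mu\cap\mu'|$, where a marriage is identified with its set of married couples, and $\mu$ is called $(1-\varepsilon)$-stable if $d(\mu,\mu')\le\varepsilon n$ for some stable marriage $\mu'$. Suppose that Alice holds the preference lists of all the women and Bob holds those of all the men, and that they want to find some $(1-\varepsilon)$-stable marriage. Then the randomized and the deterministic two-party communication complexity of this problem (Yao's model) are both $\Omega(n^2)$: for every success probability $p$ with $\tfrac12<p\le1$ (in particular for $p=\tfrac23$) there are $c>0$ and $n_0$, depending only on $\varepsilon$ and $p$, such that for every $n\ge n_0$, every randomized (even public-coin) protocol that on each fixed input outputs a $(1-\varepsilon)$-stable marriage with probability at least $p$ exchanges at least $cn^2$ bits in the worst case over inputs and coin tosses; likewise there are $c>0$ and $n_0$, depending only on $\varepsilon$, such that for every $n\ge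 n_0$, every deterministic protocol that always outputs a $(1-\varepsilon)$-stable marriage exchanges at least $cn^2$ bits on a worst-case input. -/

import Mathlib

open scoped ENNReal

/-- A full preference list over `M`: a (strict) total ordering of `M`.
`prefers m m'` means that `m` precedes `m'` on the list. -/
structure PrefList (M : Type) where
  prefers : M → M → Prop
  isStrictTotal : IsStrictTotalOrder M prefers

/-- A profile of full preference lists for `W` over `M`. -/
abbrev Profile (W M : Type) : Type := W → PrefList M

/-- A perfect marriage between `W` and `M`. -/
abbrev Marriage (W M : Type) : Type := W ≃ M

/-- `(w, m)` is a blocking pair for `μ`: each of `w` and `m` prefers the other over their spouse. -/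
def IsBlockingPair {W M : Type} (PW : Profile W M) (PM : Profile M W) (μ : Marriage W M)
    (w : W) (m : M) : Prop :=
  (PW w).prefers m (μ w) ∧ (PM m).prefers w (μ.symm m)

/-- A perfect marriage is stable if it has no blocking pair. -/
def IsStable {W M : Type} (PW : Profile W M) (PM : Profile M W) (μ : Marriage W M) : Prop :=
  ∀ w m, ¬ IsBlockingPair PW PM μ w m

/-- The set of couples married in `μ`. -/
def couples {W M : Type} (μ : Marriage W M) : Set (W × M) := {c | μ c.1 = c.2}

/-- The divorce distance `n - |μ ∩ μ'|`, where `n = |W|`. The subtraction never truncates,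
as a marriage has exactly `n` couples. -/
noncomputable def divorceDist {W M : Type} (μ μ' : Marriage W M) : ℕ :=
  Nat.card W - (couples μ ∩ couples μ').ncard

/-- `μ` is `(1 - ε)`-stable: it is within divorce distance `ε n` of some stable marriage. -/
def IsApproxStable {W M : Type} (ε : ℝ) (PW : Profile W M) (PM : Profile M W)
    (μ : Marriage W M) : Prop :=
  ∃ μ' : Marriage W M, IsStable PW PM μ' ∧ (divorceDist μ μ' : ℝ) ≤ ε * (Nat.card W : ℝ)

/-- Deterministic two-party protocols, as protocol trees: Alice holds an input in `X`, Bob an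
input in `Y`, the output is in `Z`. At an inner node one party sends one bit, which depends on
the node (the bits exchanged so far) and on that party's input; a leaf carries the output. -/
inductive Protocol (X Y Z : Type) : Type
  | output (z : Z) : Protocol X Y Z
  | alice (bit : X → Bool) (next : Bool → Protocol X Y Z) : Protocol X Y Z
  | bob (bit : Y → Bool) (next : Bool → Protocol X Y Z) : Protocol X Y Z

namespace Protocol

/-- The output of the protocol on input `(x, y)`. -/
def run {X Y Z : Type} : Protocol X Y Z → X → Y → Z
  | output z, _, _ => z
  | alice bit next, x, y => (next (bit x)).run x y
  | bob bit next, x, y => (next (bit y)).run x y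

/-- The number of bits exchanged on input `(x, y)`. -/
def bits {X Y Z : Type} : Protocol X Y Z → X → Y → ℕ
  | output _, _, _ => 0
  | alice bit next, x, y => (next (bit x)).bits x y + 1
  | bob bit next, x, y => (next (bit y)).bits x y + 1

/-- The communication cost: the number of bits exchanged for the worst input `(x, y)`. -/
noncomputable def cost {X Y Z : Type} (P : Protocol X Y Z) : ℕ∞ :=
  ⨆ (x : X) (y : Y), (P.bits x y : ℕ∞)

end Protocol

/-- The deterministic communication complexity of a search problem `R` (`R x y z` means that `z`
is a correct output on input `(x, y)`): the lowest cost of a protocol that always outputs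
correctly. -/
noncomputable def detCommComplexity {X Y Z : Type} (R : X → Y → Z → Prop) : ℕ∞ :=
  ⨅ (P : Protocol X Y Z) (_ : ∀ x y, R x y (P.run x y)), P.cost

/-- A (public-coin) randomized protocol: a probability distribution over deterministic
protocols. A protocol with private coins is the special case in which Alice's bits depend on one
and Bob's bits on another of two independent parts of the randomness. -/
abbrev RandProtocol (X Y Z : Type) : Type := PMF (Protocol X Y Z)

namespace RandProtocol

/-- The communication cost: the worst case over the inputs and the coin tosses. -/
noncomputable def cost {X Y Z : Type} (Q : RandProtocol X Y Z) : ℕ∞ :=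
  ⨆ P ∈ PMF.support Q, Protocol.cost P

/-- For every fixed input, the output is correct with probability at least `p`. -/
def Solves {X Y Z : Type} (Q : RandProtocol X Y Z) (p : ℝ) (R : X → Y → Z → Prop) : Prop :=
  ∀ x y, ENNReal.ofReal p ≤ PMF.toOuterMeasure Q {P | R x y (P.run x y)}

end RandProtocol

/-- The randomized communication complexity of a search problem `R`, with success probability
at least `p` on every input. -/
noncomputable def randCommComplexity {X Y Z : Type} (p : ℝ) (R : X → Y → Z → Prop) : ℕ∞ :=
  ⨅ (Q : RandProtocol X Y Z) (_ : RandProtocol.Solves Q p R), RandProtocol.cost Q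

/-- The problem of finding a `(1 - ε)`-stable marriage between `n` women and `n` men; the first
input is the women's profile, the second the men's profile. -/
def FindApproxStable (ε : ℝ) (n : ℕ) :
    Profile (Fin n) (Fin n) → Profile (Fin n) (Fin n) → Marriage (Fin n) (Fin n) → Prop :=
  fun PW PM μ => IsApproxStable ε PW PM μ

/-- `f n = Ω(n²)`. -/
def IsOmegaSq (f : ℕ → ℕ∞) : Prop :=
  ∃ c : ℝ, 0 < c ∧ ∃ n₀ : ℕ, ∀ n : ℕ, n₀ ≤ n →
    ENNReal.ofReal (c * (n : ℝ) ^ 2) ≤ ((f n : ℕ∞) : ℝ≥0∞)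

/-!
The proof reduces unique set disjointness on `N = m²` points, with `m` proportional to `n`, to the
search for an almost stable marriage, and proves a linear lower bound for the former.

**The marriage market.** Alice's set `x` and Bob's set `y` are sets of pairs `(i, j)`. There are
women `aᵢ`, `b'ⱼ`, `c_l` and men `a'ᵢ`, `bⱼ`, `d_l`. Woman `aᵢ` prefers `bⱼ` to her reserve `a'ᵢ`
iff `(i, j) ∈ x`, and man `bⱼ` prefers `aᵢ` to his reserve `b'ⱼ` iff `(i, j) ∈ y`. If `x` and `y`
are disjoint, then in every stable marriage everybody gets the reserve, and the chain is married
as `c_l – d_l`. If `x ∩ y = {(i, j)}`, then in every stable marriage `aᵢ` is married to `bⱼ`; the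
released woman `b'ⱼ` takes `d₀`, and rejections run along the whole chain, which ends up married as
`c_l – d_{l+1}`. The chain has more than `2εn` links, so an approximately stable marriage tells the
two cases apart (`mem_mostlyUnshifted_of_disjoint`, `notMem_mostlyUnshifted_of_inter_eq`).

**The communication bound.** This is a corruption argument in the style of Razborov. For a random
set `T` of coordinates let `x` be a random subset of `T` and `y` a random subset of its complement.
For a rectangle `A × B`, either `A` is exponentially small within the subsets of `T`, or, for all
but few coordinates `i`, putting `i` into `x` hardly changes the probability of `x ∈ A`
(`sum_le_of_biased`); the same holds for `B` and `y`. So adding a random common point `i` to both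
sets hardly decreases the probability of a rectangle (`rectangle_corruption`): the loss is a factor
`1 - O(η)` and an additive `e^{-Ω(N)}`. Summing over the leaves of a protocol tree multiplies the
additive loss by at most `2 ^ b` (`Protocol.neg_two_pow_mul_le`). As the multiplicative loss is
arbitrarily small, every success probability above `1/2` is covered without amplification, and the
deterministic bound is the case of success probability `1`.
-/

/-! ### Random subsets and biased coordinates -/

section Cube

open Finset

variable {α : Type*} [Fintype α] [DecidableEq α]

theorem sum_insert_add_sum_erase (i : α) (φ : Finset α → ℝ) :
    ∑ u, φ (insert i u) + ∑ u : Finset α, φ (u.erase i) = 2 * ∑ u, φ u := by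
  have h1 : ∑ u, φ (symmDiff u {i}) = ∑ u, φ u :=
    Equiv.sum_comp (symmDiff_left_involutive ({i} : Finset α)).toPerm φ
  have h2 : ∀ u, φ (insert i u) + φ (u.erase i) = φ u + φ (symmDiff u {i}) := by
    intro u
    by_cases hi : i ∈ u
    · have : symmDiff u {i} = u.erase i := by
        ext j; simp only [mem_symmDiff, mem_singleton, mem_erase]; grind
      rw [this, insert_eq_of_mem hi]
    · have : symmDiff u {i} = insert i u := by
        ext j; simp only [mem_symmDiff, mem_singleton, mem_insert]; grind
      rw [this, erase_eq_of_notMem hi, add_comm]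
  rw [← sum_add_distrib, sum_congr rfl fun u _ => h2 u, sum_add_distrib, h1, two_mul]

theorem sum_exp_neg_mul_card_inter (K : Finset α) (s : ℝ) :
    ∑ u : Finset α, Real.exp (-s * #(u ∩ K)) =
      2 ^ (Fintype.card α - #K) * (1 + Real.exp (-s)) ^ #K := by
  have h1 : ∀ u : Finset α,
      Real.exp (-s * #(u ∩ K)) = ∏ i ∈ u, if i ∈ K then Real.exp (-s) else 1 := by
    intro u
    rw [prod_ite, prod_const, prod_const_one, mul_one, ← Real.exp_nat_mul, filter_mem_eq_inter,
      mul_comm]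
  have h2 : ∀ i : α, (1 + if i ∈ K then Real.exp (-s) else 1) =
      if i ∈ K then 1 + Real.exp (-s) else 2 := by
    intro i; split_ifs <;> norm_num
  rw [sum_congr rfl fun u _ => h1 u, ← powerset_univ, ← prod_one_add,
    prod_congr rfl fun i _ => h2 i, prod_ite, prod_const, prod_const, mul_comm,
    filter_mem_eq_inter, univ_inter]
  congr 2
  rw [← compl_filter, filter_mem_eq_inter, univ_inter, card_compl]

/-- A `[0, 1]`-valued weight `h` on subsets that is biased away from `i`, for every `i ∈ K`, has
mean exponentially small in `#K`. The weighted mean of `#(u ∩ K)` is at most `(1 - η) / 2 * #K`,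
and the bound is the Chernoff bound for such a deviation, with Jensen's inequality for `exp`
applied in the form of its tangent line at `-z`. -/
theorem sum_le_of_biased {h : Finset α → ℝ} (h0 : ∀ u, 0 ≤ h u) (h1 : ∀ u, h u ≤ 1)
    {η : ℝ} (hη : 0 ≤ η) {K : Finset α}
    (hK : ∀ i ∈ K, ∑ u, h (insert i u) ≤ (1 - η) * ∑ u, h u) :
    ∑ u, h u ≤ 2 ^ Fintype.card α * Real.exp (-(η ^ 2 / 2 * #K)) := by
  set H := ∑ u, h u with hH
  -- `s = 2η` minimizes the exponent `s² / 8 - s η / 2` of the Chernoff bound.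
  set s : ℝ := 2 * η with hs
  set z : ℝ := s * ((1 - η) / 2 * #K) with hz
  have hmean : ∑ u, h u * #(u ∩ K) ≤ (1 - η) / 2 * #K * H := by
    have hi : ∀ i ∈ K, (∑ u, if i ∈ u then h u else 0) ≤ (1 - η) / 2 * H := by
      intro i hi
      have := sum_insert_add_sum_erase i fun u => if i ∈ u then h u else 0
      simp only [mem_insert_self, if_true, notMem_erase, if_false, sum_const_zero] at this
      linarith [hK i hi]
    calc ∑ u, h u * #(u ∩ K) = ∑ u, ∑ i ∈ K, if i ∈ u then h u else 0 := by
          refine sum_congr rfl fun u _ => ?_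
          rw [← sum_filter, sum_const, nsmul_eq_mul, mul_comm, filter_mem_eq_inter, inter_comm]
      _ = ∑ i ∈ K, ∑ u, if i ∈ u then h u else 0 := sum_comm
      _ ≤ ∑ i ∈ K, (1 - η) / 2 * H := sum_le_sum hi
      _ = (1 - η) / 2 * #K * H := by rw [sum_const, nsmul_eq_mul]; ring
  have hlow : Real.exp (-z) * H ≤ ∑ u : Finset α, Real.exp (-s * #(u ∩ K)) := by
    calc Real.exp (-z) * H
        ≤ Real.exp (-z) * (H + s * ((1 - η) / 2 * #K * H - ∑ u, h u * #(u ∩ K))) := by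
          gcongr
          have : 0 ≤ s * ((1 - η) / 2 * #K * H - ∑ u, h u * #(u ∩ K)) :=
            mul_nonneg (by positivity) (by linarith)
          linarith
      _ = ∑ u, h u * (Real.exp (-z) * (1 + (z - s * #(u ∩ K)))) := by
          have : ∀ u, h u * (Real.exp (-z) * (1 + (z - s * #(u ∩ K)))) =
              Real.exp (-z) * ((1 + z) * h u - s * (h u * #(u ∩ K))) := fun u => by ring
          rw [sum_congr rfl fun u _ => this u, ← mul_sum, sum_sub_distrib, ← mul_sum, ← mul_sum,
            hz]
          ring
      _ ≤ ∑ u : Finset α, 1 * Real.exp (-s * #(u ∩ K)) := by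
          refine sum_le_sum fun u _ => ?_
          have : Real.exp (-z) * (1 + (z - s * #(u ∩ K))) ≤ Real.exp (-s * #(u ∩ K)) := by
            have e : Real.exp (-s * #(u ∩ K)) = Real.exp (-z) * Real.exp (z - s * #(u ∩ K)) := by
              rw [← Real.exp_add]; congr 1; ring
            rw [e]
            gcongr
            linarith [Real.add_one_le_exp (z - s * #(u ∩ K))]
          exact (mul_le_mul_of_nonneg_left this (h0 u)).trans
            (mul_le_mul_of_nonneg_right (h1 u) (Real.exp_pos _).le)
      _ = _ := by simp only [one_mul]
  rw [sum_exp_neg_mul_card_inter] at hlow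
  have hcosh : 1 + Real.exp (-s) ≤ 2 * Real.exp (η ^ 2 / 2 - η) := by
    have e1 : 1 + Real.exp (-s) = 2 * (Real.cosh η * Real.exp (-η)) := by
      rw [Real.cosh_eq, div_mul_eq_mul_div, add_mul, ← Real.exp_add, ← Real.exp_add,
        show η + -η = 0 by ring, show -η + -η = -s by rw [hs]; ring, Real.exp_zero]
      ring
    rw [e1, sub_eq_add_neg, Real.exp_add]
    gcongr
    exact Real.cosh_le_exp_half_sq η
  have hKcard : #K ≤ Fintype.card α := card_le_univ K
  calc H = Real.exp z * (Real.exp (-z) * H) := by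
        rw [← mul_assoc, ← Real.exp_add, add_neg_cancel, Real.exp_zero, one_mul]
    _ ≤ Real.exp z * (2 ^ (Fintype.card α - #K) * (2 * Real.exp (η ^ 2 / 2 - η)) ^ #K) := by
        refine mul_le_mul_of_nonneg_left (hlow.trans ?_) (Real.exp_pos z).le
        gcongr
    _ = 2 ^ (Fintype.card α - #K) * 2 ^ #K *
          (Real.exp z * Real.exp (η ^ 2 / 2 - η) ^ #K) := by rw [mul_pow]; ring
    _ = _ := by
        rw [← pow_add, Nat.sub_add_cancel hKcard, ← Real.exp_nat_mul, ← Real.exp_add, hz, hs]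
        congr 2
        ring

/-- Either `h` has an exponentially small mean, or at most `η * card α` coordinates are biased
against for `h`; this bounds the product of the number of these coordinates and the sum of `h` in
both cases at once. -/
theorem card_biased_mul_sum_le {h : Finset α → ℝ} (h0 : ∀ u, 0 ≤ h u) (h1 : ∀ u, h u ≤ 1)
    {η : ℝ} (hη : 0 ≤ η) :
    #{i | ∑ u, h (insert i u) < (1 - η) * ∑ u, h u} * ∑ u, h u ≤
      Fintype.card α * (η * ∑ u, h u +
        2 ^ Fintype.card α * Real.exp (-(η ^ 3 / 2 * Fintype.card α))) := by
  set K : Finset α := {i | ∑ u, h (insert i u) < (1 - η) * ∑ u, h u} with hK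
  have hH : 0 ≤ ∑ u, h u := sum_nonneg fun u _ => h0 u
  have hKcard : (#K : ℝ) ≤ Fintype.card α := by exact_mod_cast card_le_univ K
  by_cases hc : (#K : ℝ) ≤ η * Fintype.card α
  · have : (#K : ℝ) * ∑ u, h u ≤ Fintype.card α * (η * ∑ u, h u) := by
      nlinarith [mul_le_mul_of_nonneg_right hc hH]
    refine this.trans ?_
    gcongr
    linarith [show (0 : ℝ) ≤ 2 ^ Fintype.card α * Real.exp (-(η ^ 3 / 2 * Fintype.card α)) by
      positivity]
  · have hb := sum_le_of_biased h0 h1 hη (K := K) fun i hi => (mem_filter.1 hi).2.le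
    have he : Real.exp (-(η ^ 2 / 2 * #K)) ≤ Real.exp (-(η ^ 3 / 2 * Fintype.card α)) := by
      refine Real.exp_le_exp.2 (neg_le_neg ?_)
      nlinarith [mul_le_mul_of_nonneg_left (not_le.1 hc).le (by positivity : 0 ≤ η ^ 2 / 2)]
    calc (#K : ℝ) * ∑ u, h u
        ≤ Fintype.card α * (2 ^ Fintype.card α *
            Real.exp (-(η ^ 3 / 2 * Fintype.card α))) := by
          gcongr
          exact hb.trans (by gcongr)
      _ ≤ _ := by
          gcongr
          linarith [mul_nonneg hη hH]

/-- The corruption bound for a rectangle, with `f` and `g` in the role of the indicators of its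
sides. The left-hand side is, up to its factor, the mass of the disjoint pairs
`((u ∩ T) \ {i}, (v \ T) \ {i})`; the first sum on the right is the mass of the pairs meeting
exactly in `i` that arise by adding `i` to both sides. The term with factor `8 * η` is what coordinates biased for one of the two sides can
contribute: it is small because there are few of them for each `T`. -/
theorem rectangle_corruption {f g : Finset α → ℝ} (f0 : ∀ u, 0 ≤ f u) (f1 : ∀ u, f u ≤ 1)
    (g0 : ∀ u, 0 ≤ g u) (g1 : ∀ u, g u ≤ 1) {η : ℝ} (hη : 0 ≤ η) (hη' : η ≤ 1 / 4) :
    (1 - 4 * η) * ∑ i : α, ∑ T : Finset α,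
        (∑ u, f ((u ∩ T).erase i)) * ∑ v, g ((v \ T).erase i) ≤
      ∑ i : α, ∑ T : Finset α, (∑ u, f (insert i (u ∩ T))) * (∑ v, g (insert i (v \ T))) +
      8 * η * Fintype.card α * ∑ T : Finset α, (∑ u, f (u ∩ T)) * ∑ v, g (v \ T) +
      8 * Fintype.card α * 8 ^ Fintype.card α *
        Real.exp (-(η ^ 3 / 2 * Fintype.card α)) := by
  set N := Fintype.card α with hN
  set F : Finset α → ℝ := fun T => ∑ u, f (u ∩ T) with hF
  set G : Finset α → ℝ := fun T => ∑ v, g (v \ T) with hG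
  set E : ℝ := 2 ^ N * Real.exp (-(η ^ 3 / 2 * N)) with hE
  have F0 : ∀ T, 0 ≤ F T := fun T => sum_nonneg fun _ _ => f0 _
  have G0 : ∀ T, 0 ≤ G T := fun T => sum_nonneg fun _ _ => g0 _
  have hcard : (Fintype.card (Finset α) : ℝ) = 2 ^ N := by simp [hN]
  have F1 : ∀ T, F T ≤ 2 ^ N := fun T => by
    rw [← hcard, Fintype.card, ← nsmul_one]; exact sum_le_card_nsmul _ _ _ fun _ _ => f1 _
  have G1 : ∀ T, G T ≤ 2 ^ N := fun T => by
    rw [← hcard, Fintype.card, ← nsmul_one]; exact sum_le_card_nsmul _ _ _ fun _ _ => g1 _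
  set BF : Finset α → Finset α :=
    fun T => {i | ∑ u, f (insert i u ∩ T) < (1 - η) * ∑ u, f (u ∩ T)} with hBF
  set BG : Finset α → Finset α :=
    fun T => {i | ∑ v, g (insert i v \ T) < (1 - η) * ∑ v, g (v \ T)} with hBG
  have hbF : ∀ T, #(BF T) * F T ≤ N * (η * F T + E) := fun T =>
    card_biased_mul_sum_le (h := fun u => f (u ∩ T)) (fun _ => f0 _) (fun _ => f1 _) hη
  have hbG : ∀ T, #(BG T) * G T ≤ N * (η * G T + E) := fun T =>
    card_biased_mul_sum_le (h := fun u => g (u \ T)) (fun _ => g0 _) (fun _ => g1 _) hη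
  -- A coordinate that is biased for `f` is charged to `insert i T`, where `f0 + f1 = 2 F`; one that
  -- is biased for `g` is charged to `T.erase i`, where `g0 + g1 = 2 G`.
  set RF : α → Finset α → ℝ := fun i T => if i ∈ BF T then F T * G T else 0 with hRF
  set RG : α → Finset α → ℝ := fun i T => if i ∈ BG T then F T * G T else 0 with hRG
  have RF0 : ∀ i T, 0 ≤ RF i T := fun i T => by
    simp only [hRF]; split_ifs; exacts [mul_nonneg (F0 T) (G0 T), le_rfl]
  have RG0 : ∀ i T, 0 ≤ RG i T := fun i T => by
    simp only [hRG]; split_ifs; exacts [mul_nonneg (F0 T) (G0 T), le_rfl]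
  have hpoint : ∀ i T, (1 - 4 * η) *
      ((∑ u, f ((u ∩ T).erase i)) * ∑ v, g ((v \ T).erase i)) ≤
      (∑ u, f (insert i (u ∩ T))) * (∑ v, g (insert i (v \ T))) +
        (2 * RF i (insert i T) + 2 * RG i (T.erase i)) := by
    intro i T
    have ef0 : F (T.erase i) = ∑ u, f ((u ∩ T).erase i) := by
      refine sum_congr rfl fun u _ => ?_
      rw [inter_erase]
    have eg0 : G (insert i T) = ∑ v, g ((v \ T).erase i) := by
      refine sum_congr rfl fun u _ => ?_
      rw [sdiff_insert]
    have ef1 : ∀ u : Finset α, insert i u ∩ insert i T = insert i (u ∩ T) := fun u => by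
      rw [insert_inter_distrib]
    have eg1 : ∀ u : Finset α, insert i u \ T.erase i = insert i (u \ T) := fun u => by
      ext j; simp only [mem_sdiff, mem_insert, mem_erase]; grind
    have ef2 : ∀ u : Finset α, u.erase i ∩ insert i T = (u ∩ T).erase i := fun u => by
      ext j; simp only [mem_inter, mem_insert, mem_erase]; grind
    have eg2 : ∀ u : Finset α, u.erase i \ T.erase i = (u \ T).erase i := fun u => by
      ext j; simp only [mem_sdiff, mem_erase]; grind
    have sf := sum_insert_add_sum_erase i fun u => f (u ∩ insert i T)
    have sg := sum_insert_add_sum_erase i fun u => g (u \ T.erase i)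
    simp only [ef1, ef2] at sf
    simp only [eg1, eg2] at sg
    have bf : i ∈ BF (insert i T) ↔
        ∑ u, f (insert i (u ∩ T)) < (1 - η) * F (insert i T) := by
      simp only [hBF, mem_filter, mem_univ, true_and, ef1, hF]
    have bg : i ∈ BG (T.erase i) ↔
        ∑ v, g (insert i (v \ T)) < (1 - η) * G (T.erase i) := by
      simp only [hBG, mem_filter, mem_univ, true_and, eg1, hG]
    change _ + _ = 2 * F (insert i T) at sf
    change _ + _ = 2 * G (T.erase i) at sg
    have a1 : 0 ≤ ∑ u, f (insert i (u ∩ T)) := sum_nonneg fun _ _ => f0 _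
    have b1 : 0 ≤ ∑ v, g (insert i (v \ T)) := sum_nonneg fun _ _ => g0 _
    have hRF0 := RF0 i (insert i T)
    have hRG0 := RG0 i (T.erase i)
    rw [← ef0] at sf ⊢
    rw [← eg0] at sg ⊢
    have a0 := F0 (T.erase i)
    have b0 := G0 (insert i T)
    have ab := mul_nonneg a0 b0
    have ab1 := mul_nonneg a1 b1
    set a := ∑ u, f (insert i (u ∩ T))
    set b := ∑ v, g (insert i (v \ T))
    by_cases hf : i ∈ BF (insert i T)
    · have : RF i (insert i T) = F (insert i T) * G (insert i T) := if_pos hf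
      have h2 : F (T.erase i) ≤ 2 * F (insert i T) := by linarith
      have := mul_le_mul_of_nonneg_right h2 b0
      nlinarith
    by_cases hg : i ∈ BG (T.erase i)
    · have : RG i (T.erase i) = F (T.erase i) * G (T.erase i) := if_pos hg
      have h2 : G (insert i T) ≤ 2 * G (T.erase i) := by linarith
      have := mul_le_mul_of_nonneg_left h2 a0
      nlinarith
    rw [bf, not_lt] at hf
    rw [bg, not_lt] at hg
    have key : ∀ x y z : ℝ, 0 ≤ x → 0 ≤ z → x + y = 2 * z → (1 - η) * z ≤ x →
        (1 - 2 * η) * y ≤ x := by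
      intro x y z hx hz hxy hzx
      have : y ≤ (1 + η) * z := by linarith
      have := mul_le_mul_of_nonneg_left this (by linarith : 0 ≤ 1 - 2 * η)
      nlinarith [mul_nonneg (mul_nonneg hη hη) hz, mul_nonneg hη hz]
    have ka := key _ _ _ a1 (F0 _) sf hf
    have kb := key _ _ _ b1 (G0 _) sg hg
    have := mul_le_mul ka kb (mul_nonneg (by linarith) b0) a1
    nlinarith [mul_nonneg (mul_nonneg hη hη) ab]
  have hsumF : ∑ i, ∑ T, RF i (insert i T) ≤
      2 * (N * (η * ∑ T, F T * G T) + N * (2 ^ N * (E * 2 ^ N))) := by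
    calc ∑ i, ∑ T, RF i (insert i T) ≤ ∑ i, 2 * ∑ T, RF i T := by
          refine sum_le_sum fun i _ => ?_
          rw [← sum_insert_add_sum_erase i (RF i)]
          exact le_add_of_nonneg_right (sum_nonneg fun _ _ => RF0 _ _)
      _ = 2 * ∑ T, #(BF T) * F T * G T := by
          rw [← mul_sum, sum_comm]
          congr 1
          refine sum_congr rfl fun T _ => ?_
          simp only [hRF]
          rw [← sum_filter, sum_const, nsmul_eq_mul, mul_assoc]
          simp
      _ ≤ 2 * ∑ T, (N * (η * (F T * G T)) + N * (E * 2 ^ N)) := by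
          gcongr with T
          have h1 := mul_le_mul_of_nonneg_right (hbF T) (G0 T)
          have h2 : N * (E * G T) ≤ N * (E * 2 ^ N) := by gcongr; exact G1 T
          linarith
      _ = _ := by
          rw [sum_add_distrib, ← mul_sum, ← mul_sum, sum_const, nsmul_eq_mul, card_univ, hcard]
          ring
  have hsumG : ∑ i, ∑ T : Finset α, RG i (T.erase i) ≤
      2 * (N * (η * ∑ T, F T * G T) + N * (2 ^ N * (E * 2 ^ N))) := by
    calc ∑ i, ∑ T : Finset α, RG i (T.erase i) ≤ ∑ i, 2 * ∑ T, RG i T := by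
          refine sum_le_sum fun i _ => ?_
          rw [← sum_insert_add_sum_erase i (RG i)]
          exact le_add_of_nonneg_left (sum_nonneg fun _ _ => RG0 _ _)
      _ = 2 * ∑ T, #(BG T) * G T * F T := by
          rw [← mul_sum, sum_comm]
          congr 1
          refine sum_congr rfl fun T _ => ?_
          simp only [hRG]
          rw [← sum_filter, sum_const, nsmul_eq_mul, mul_assoc, mul_comm (F T)]
          simp
      _ ≤ 2 * ∑ T, (N * (η * (F T * G T)) + N * (E * 2 ^ N)) := by
          gcongr with T
          have h1 := mul_le_mul_of_nonneg_right (hbG T) (F0 T)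
          have h2 : N * (E * F T) ≤ N * (E * 2 ^ N) := by gcongr; exact F1 T
          linarith
      _ = _ := by
          rw [sum_add_distrib, ← mul_sum, ← mul_sum, sum_const, nsmul_eq_mul, card_univ, hcard]
          ring
  have hE8 : 8 * (N : ℝ) * 8 ^ N * Real.exp (-(η ^ 3 / 2 * N)) =
      8 * (N * (2 ^ N * (E * 2 ^ N))) := by
    rw [hE, show (8 : ℝ) = 2 * 2 * 2 by norm_num, mul_pow, mul_pow]
    ring
  rw [hE8]
  have := sum_le_sum fun i (_ : i ∈ univ) => sum_le_sum fun T (_ : T ∈ univ) => hpoint i T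
  simp only [sum_add_distrib, ← mul_sum] at this ⊢
  linarith

end Cube

/-! ### From rectangles to protocols -/

section Protocols

open Finset

/-- An additive functional that is at least `-E` on all rectangles `f ⊗ g` is at least
`-(2 ^ b * E)` on the set of inputs on which a protocol that uses at most `b` bits answers in `S`.
The induction restricts `f` and `g` to the inputs compatible with the bits sent so far. -/
theorem Protocol.neg_two_pow_mul_le {X Y Z : Type} {L : (X → Y → ℝ) → ℝ}
    (hadd : ∀ φ ψ, L (fun x y => φ x y + ψ x y) = L φ + L ψ) {E : ℝ} (hE : 0 ≤ E)
    (hrect : ∀ (f : X → ℝ) (g : Y → ℝ), (∀ x, 0 ≤ f x) → (∀ x, f x ≤ 1) → (∀ y, 0 ≤ g y) →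
      (∀ y, g y ≤ 1) → -E ≤ L fun x y => f x * g y)
    (S : Set Z) (P : Protocol X Y Z) :
    ∀ (b : ℕ) (f : X → ℝ) (g : Y → ℝ), (∀ x, 0 ≤ f x) → (∀ x, f x ≤ 1) → (∀ y, 0 ≤ g y) →
      (∀ y, g y ≤ 1) → (∀ x y, f x ≠ 0 → g y ≠ 0 → P.bits x y ≤ b) →
      -(2 ^ b * E) ≤ L fun x y => f x * g y * S.indicator 1 (P.run x y) := by
  have hE' : ∀ b : ℕ, -(2 ^ b * E) ≤ -E := fun b =>
    neg_le_neg (le_mul_of_one_le_left hE (one_le_pow₀ one_le_two))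
  have hzero : ∀ b : ℕ, -(2 ^ b * E) ≤ L fun _ _ => 0 := fun b => (hE' b).trans <| by
    simpa using hrect (fun _ => 0) (fun _ => 0) (by simp) (by simp) (by simp) (by simp)
  induction P with
  | output z =>
    intro b f g f0 f1 g0 g1 _
    by_cases hz : z ∈ S
    · simpa [Protocol.run, hz] using (hE' b).trans (hrect f g f0 f1 g0 g1)
    · simpa [Protocol.run, hz] using hzero b
  | alice bit next ih =>
    intro b f g f0 f1 g0 g1 hb
    cases b with
    | zero =>
      have : ∀ x y, f x * g y = 0 := by
        intro x y
        by_contra h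
        have := hb x y (left_ne_zero_of_mul h) (right_ne_zero_of_mul h)
        simp [Protocol.bits] at this
      simpa [this] using hzero 0
    | succ b =>
      have key : ∀ c : Bool, -(2 ^ b * E) ≤
          L fun x y => (if bit x = c then f x else 0) * g y *
            S.indicator 1 ((next c).run x y) := by
        intro c
        refine ih c b _ g (fun x => ?_) (fun x => ?_) g0 g1 fun x y hx hy => ?_
        · split_ifs; exacts [f0 x, le_rfl]
        · split_ifs; exacts [f1 x, zero_le_one]
        · have hc : bit x = c := by by_contra h; simp [h] at hx
          have := hb x y (by simpa [hc] using hx) hy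
          simpa [Protocol.bits, hc] using this
      have hsum := hadd
        (fun x y => (if bit x = true then f x else 0) * g y *
            S.indicator 1 ((next true).run x y))
        (fun x y => (if bit x = false then f x else 0) * g y *
            S.indicator 1 ((next false).run x y))
      have heq : (fun x y => f x * g y *
          S.indicator (1 : Z → ℝ) ((Protocol.alice bit next).run x y)) = fun x y =>
          (if bit x = true then f x else 0) * g y * S.indicator 1 ((next true).run x y) +
          (if bit x = false then f x else 0) * g y * S.indicator 1 ((next false).run x y) := by
        funext x y
        cases h : bit x <;> simp [Protocol.run, h]
      rw [heq, hsum, pow_succ]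
      linarith [key true, key false]
  | bob bit next ih =>
    intro b f g f0 f1 g0 g1 hb
    cases b with
    | zero =>
      have : ∀ x y, f x * g y = 0 := by
        intro x y
        by_contra h
        have := hb x y (left_ne_zero_of_mul h) (right_ne_zero_of_mul h)
        simp [Protocol.bits] at this
      simpa [this] using hzero 0
    | succ b =>
      have key : ∀ c : Bool, -(2 ^ b * E) ≤
          L fun x y => f x * (if bit y = c then g y else 0) *
            S.indicator 1 ((next c).run x y) := by
        intro c
        refine ih c b f _ f0 f1 (fun y => ?_) (fun y => ?_) fun x y hx hy => ?_
        · split_ifs; exacts [g0 y, le_rfl]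
        · split_ifs; exacts [g1 y, zero_le_one]
        · have hc : bit y = c := by by_contra h; simp [h] at hy
          have := hb x y hx (by simpa [hc] using hy)
          simpa [Protocol.bits, hc] using this
      have hsum := hadd
        (fun x y => f x * (if bit y = true then g y else 0) *
            S.indicator 1 ((next true).run x y))
        (fun x y => f x * (if bit y = false then g y else 0) *
            S.indicator 1 ((next false).run x y))
      have heq : (fun x y => f x * g y *
          S.indicator (1 : Z → ℝ) ((Protocol.bob bit next).run x y)) = fun x y =>
          f x * (if bit y = true then g y else 0) * S.indicator 1 ((next true).run x y) +
          f x * (if bit y = false then g y else 0) * S.indicator 1 ((next false).run x y) := by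
        funext x y
        cases h : bit y <;> simp [Protocol.run, h]
      rw [heq, hsum, pow_succ]
      linarith [key true, key false]

theorem sum_sum_mul_sum_eq {α : Type} [Fintype α] (φ ψ : α → Finset α → Finset α → ℝ) :
    ∑ i, ∑ T, (∑ u, φ i T u) * ∑ v, ψ i T v =
      ∑ t : α × Finset α × Finset α × Finset α,
        φ t.1 t.2.1 t.2.2.1 * ψ t.1 t.2.1 t.2.2.2 := by
  simp only [Fintype.sum_prod_type, sum_mul_sum]

variable {α : Type} [Fintype α] [DecidableEq α]

/-- For a deterministic protocol with at most `b` bits, the answers in `S` on the random disjoint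
inputs and the answers outside `S` on the random inputs meeting in one point have total frequency
hardly above `1`. Inputs are drawn by `t = (i, T, u, v)`: Alice's set is `u ∩ T` and Bob's is
`v \ T`, with `i` removed from or added to both. -/
theorem Protocol.sum_indicator_add_sum_indicator_le {X Y Z : Type} (pX : Finset α → X)
    (pY : Finset α → Y) (S : Set Z) {η : ℝ} (hη : 0 ≤ η) (hη' : η ≤ 1 / 4)
    (P : Protocol X Y Z) {b : ℕ} (hb : ∀ x y, P.bits x y ≤ b) :
    ∑ t : α × Finset α × Finset α × Finset α,
        (S.indicator (1 : Z → ℝ)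
            (P.run (pX ((t.2.2.1 ∩ t.2.1).erase t.1)) (pY ((t.2.2.2 \ t.2.1).erase t.1))) +
          Sᶜ.indicator (1 : Z → ℝ)
            (P.run (pX (insert t.1 (t.2.2.1 ∩ t.2.1))) (pY (insert t.1 (t.2.2.2 \ t.2.1))))) ≤
      (1 + 12 * η + 8 * 2 ^ b * Real.exp (-(η ^ 3 / 2 * Fintype.card α))) *
        Fintype.card (α × Finset α × Finset α × Finset α) := by
  set N := Fintype.card α with hN
  have hcard : (Fintype.card (α × Finset α × Finset α × Finset α) : ℝ) = N * 8 ^ N := by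
    rw [show (8 : ℝ) = 2 * (2 * 2) by norm_num, mul_pow, mul_pow]
    simp [Fintype.card_prod, ← hN]
  have hcard' : (Fintype.card (Finset α × Finset α × Finset α) : ℝ) = 8 ^ N := by
    rw [show (8 : ℝ) = 2 * (2 * 2) by norm_num, mul_pow, mul_pow]
    simp [Fintype.card_prod, ← hN]
  -- `rectangle_corruption` says that this functional is almost nonnegative on rectangles.
  set L : (X → Y → ℝ) → ℝ := fun φ =>
    ∑ t : α × Finset α × Finset α × Finset α,
      φ (pX (insert t.1 (t.2.2.1 ∩ t.2.1))) (pY (insert t.1 (t.2.2.2 \ t.2.1))) +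
    8 * η * N * ∑ t : Finset α × Finset α × Finset α,
      φ (pX (t.2.1 ∩ t.1)) (pY (t.2.2 \ t.1)) -
    (1 - 4 * η) * ∑ t : α × Finset α × Finset α × Finset α,
      φ (pX ((t.2.2.1 ∩ t.2.1).erase t.1)) (pY ((t.2.2.2 \ t.2.1).erase t.1)) with hL
  have hadd : ∀ φ ψ, L (fun x y => φ x y + ψ x y) = L φ + L ψ := by
    intro φ ψ
    simp only [hL, sum_add_distrib]
    ring
  set E : ℝ := 8 * N * 8 ^ N * Real.exp (-(η ^ 3 / 2 * N)) with hE
  have hrect : ∀ (f : X → ℝ) (g : Y → ℝ), (∀ x, 0 ≤ f x) → (∀ x, f x ≤ 1) →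
      (∀ y, 0 ≤ g y) → (∀ y, g y ≤ 1) → -E ≤ L fun x y => f x * g y := by
    intro f g f0 f1 g0 g1
    have := rectangle_corruption (f := fun u => f (pX u)) (g := fun v => g (pY v)) (fun _ => f0 _)
      (fun _ => f1 _) (fun _ => g0 _) (fun _ => g1 _) hη hη'
    rw [sum_sum_mul_sum_eq (fun i T u => f (pX ((u ∩ T).erase i)))
        (fun i T v => g (pY ((v \ T).erase i))),
      sum_sum_mul_sum_eq (fun i T u => f (pX (insert i (u ∩ T))))
        (fun i T v => g (pY (insert i (v \ T))))] at this
    have h3 : ∑ T : Finset α, (∑ u, f (pX (u ∩ T))) * ∑ v, g (pY (v \ T)) =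
        ∑ t : Finset α × Finset α × Finset α, f (pX (t.2.1 ∩ t.1)) * g (pY (t.2.2 \ t.1)) := by
      simp only [Fintype.sum_prod_type, sum_mul_sum]
    rw [h3] at this
    simp only [hL]
    linarith
  have main := P.neg_two_pow_mul_le hadd (by positivity : 0 ≤ E) hrect S b 1 1 (by simp)
    (by simp) (by simp) (by simp) fun x y _ _ => hb x y
  simp only [hL, Pi.one_apply, one_mul] at main
  have i0 : ∀ z, 0 ≤ S.indicator (1 : Z → ℝ) z := fun z =>
    Set.indicator_nonneg (fun _ _ => zero_le_one) z
  have i1 : ∀ z, S.indicator (1 : Z → ℝ) z ≤ 1 := fun z =>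
    Set.indicator_le_self' (fun _ _ => zero_le_one) z
  have hmid : ∑ t : Finset α × Finset α × Finset α,
      S.indicator (1 : Z → ℝ) (P.run (pX (t.2.1 ∩ t.1)) (pY (t.2.2 \ t.1))) ≤ 8 ^ N := by
    rw [← hcard', Fintype.card, ← nsmul_one]
    exact sum_le_card_nsmul _ _ _ fun _ _ => i1 _
  have hno : ∑ t : α × Finset α × Finset α × Finset α, S.indicator (1 : Z → ℝ)
      (P.run (pX ((t.2.2.1 ∩ t.2.1).erase t.1)) (pY ((t.2.2.2 \ t.2.1).erase t.1))) ≤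
      N * 8 ^ N := by
    rw [← hcard, Fintype.card, ← nsmul_one]
    exact sum_le_card_nsmul _ _ _ fun _ _ => i1 _
  have hcompl : ∀ z, Sᶜ.indicator (1 : Z → ℝ) z = 1 - S.indicator (1 : Z → ℝ) z := fun z => by
    by_cases hz : z ∈ S <;> simp [hz]
  simp only [hcompl, sum_add_distrib, sum_sub_distrib, sum_const, nsmul_eq_mul, mul_one]
  rw [card_univ, hcard]
  have h8 := mul_le_mul_of_nonneg_left hmid (by positivity : 0 ≤ 8 * η * N)
  have h4 := mul_le_mul_of_nonneg_left hno (by positivity : 0 ≤ 4 * η)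
  rw [hE] at main
  linarith

/-- If the correct answers lie in `S` on disjoint sets and outside `S` on sets with exactly one
common point, then a randomized protocol with success probability `p` and at most `b` bits
satisfies `2 p ≤ 1 + O(η) + 2 ^ b e^{-Ω(η³ N)}`. -/
theorem RandProtocol.two_mul_le_of_separates {X Y Z : Type} [Nonempty α]
    {R : X → Y → Z → Prop} (pX : Finset α → X) (pY : Finset α → Y) (S : Set Z)
    (hdisj : ∀ x y, Disjoint x y → ∀ z, R (pX x) (pY y) z → z ∈ S)
    (hinter : ∀ x y i, x ∩ y = {i} → ∀ z, R (pX x) (pY y) z → z ∉ S)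
    {η : ℝ} (hη : 0 ≤ η) (hη' : η ≤ 1 / 4) {p : ℝ} {Q : RandProtocol X Y Z}
    (hQ : Q.Solves p R) {b : ℕ} (hb : Q.cost ≤ b) :
    2 * p ≤ 1 + 12 * η + 8 * 2 ^ b * Real.exp (-(η ^ 3 / 2 * Fintype.card α)) := by
  set K := 1 + 12 * η + 8 * 2 ^ b * Real.exp (-(η ^ 3 / 2 * Fintype.card α)) with hK
  have hK0 : 0 ≤ K := by positivity
  set I := α × Finset α × Finset α × Finset α
  have hIpos : 0 < (Fintype.card I : ℝ) := by exact_mod_cast Fintype.card_pos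
  -- The number of inputs, among the disjoint and the intersecting pair drawn by `t`, on which `P`
  -- answers on the side of `S` where every correct answer lies.
  set c : Protocol X Y Z → I → ℝ := fun P t =>
    S.indicator (1 : Z → ℝ)
        (P.run (pX ((t.2.2.1 ∩ t.2.1).erase t.1)) (pY ((t.2.2.2 \ t.2.1).erase t.1))) +
      Sᶜ.indicator (1 : Z → ℝ)
        (P.run (pX (insert t.1 (t.2.2.1 ∩ t.2.1))) (pY (insert t.1 (t.2.2.2 \ t.2.1)))) with hc
  have hupper : ∀ P ∈ PMF.support Q, ∑ t, c P t ≤ K * Fintype.card I := fun P hP => by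
    refine Protocol.sum_indicator_add_sum_indicator_le pX pY S hη hη' P fun x y => ?_
    have h1 : (P.bits x y : ℕ∞) ≤ P.cost := le_iSup₂ (f := fun x y => (P.bits x y : ℕ∞)) x y
    have h2 : P.cost ≤ Q.cost := le_iSup₂ (f := fun P (_ : P ∈ PMF.support Q) => P.cost) P hP
    exact_mod_cast h1.trans (h2.trans hb)
  have hpr : ∀ (U : Set Z) x y, (∀ z, R x y z → z ∈ U) →
      ENNReal.ofReal p ≤ ∑' P, Q P * ENNReal.ofReal (U.indicator (1 : Z → ℝ) (P.run x y)) := by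
    intro U x y hU
    refine (hQ x y).trans ?_
    rw [PMF.toOuterMeasure_apply]
    refine ENNReal.tsum_le_tsum fun P => ?_
    by_cases hP : R x y (P.run x y)
    · simp [hP, hU _ hP]
    · simp [hP]
  have hlower : ∀ t, 2 * ENNReal.ofReal p ≤ ∑' P, Q P * ENNReal.ofReal (c P t) := by
    intro t
    have h0 : ∀ (U : Set Z) z, 0 ≤ U.indicator (1 : Z → ℝ) z := fun U z =>
      Set.indicator_nonneg (fun _ _ => zero_le_one) z
    simp only [hc, ENNReal.ofReal_add (h0 _ _) (h0 _ _), mul_add]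
    rw [ENNReal.tsum_add, two_mul]
    refine add_le_add (hpr _ _ _ (hdisj _ _ ?_)) (hpr _ _ _ (hinter _ _ t.1 ?_))
    · rw [disjoint_left]; intro j; simp only [mem_erase, mem_inter, mem_sdiff]; tauto
    · ext j; simp only [mem_inter, mem_insert, mem_sdiff, mem_singleton]; tauto
  have hc0 : ∀ P t, 0 ≤ c P t := fun P t => add_nonneg
    (Set.indicator_nonneg (fun _ _ => zero_le_one) _)
    (Set.indicator_nonneg (fun _ _ => zero_le_one) _)
  have : ENNReal.ofReal (Fintype.card I * (2 * p)) ≤ ENNReal.ofReal (K * Fintype.card I) := by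
    calc ENNReal.ofReal (Fintype.card I * (2 * p)) = ∑ _t : I, 2 * ENNReal.ofReal p := by
          rw [sum_const, nsmul_eq_mul, ENNReal.ofReal_mul (by positivity),
            ENNReal.ofReal_mul (by positivity)]
          simp [card_univ]
      _ ≤ ∑ t, ∑' P, Q P * ENNReal.ofReal (c P t) := sum_le_sum fun t _ => hlower t
      _ = ∑' P, Q P * ENNReal.ofReal (∑ t, c P t) := by
          rw [← Summable.tsum_finsetSum fun _ _ => ENNReal.summable]
          refine tsum_congr fun P => ?_
          rw [ENNReal.ofReal_sum_of_nonneg fun t _ => hc0 P t, mul_sum]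
      _ ≤ ∑' P, Q P * ENNReal.ofReal (K * Fintype.card I) := by
          refine ENNReal.tsum_le_tsum fun P => ?_
          by_cases hP : P ∈ PMF.support Q
          · gcongr; exact hupper P hP
          · rw [PMF.mem_support_iff, not_not] at hP
            simp [hP]
      _ = _ := by rw [ENNReal.tsum_mul_right, PMF.tsum_coe, one_mul]
  rw [ENNReal.ofReal_le_ofReal_iff (by positivity), mul_comm] at this
  exact le_of_mul_le_mul_right this hIpos

end Protocols

/-! ### The marriage market -/

section Gadget

open Finset

/-- The preference list that orders by `r`, ties being broken by the order of `M`. -/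
def PrefList.ofRank {M : Type} [LinearOrder M] (r : M → ℕ) : PrefList M where
  prefers a b := toLex (r a, a) < toLex (r b, b)
  isStrictTotal :=
    { trichotomous := fun a b h h' => by
        have := le_antisymm (not_lt.1 h') (not_lt.1 h)
        exact (Prod.ext_iff.1 (toLex.injective this)).2
      irrefl := fun a => lt_irrefl _
      trans := fun a b c h h' => lt_trans h h' }

theorem PrefList.ofRank_prefers_of_lt {M : Type} [LinearOrder M] {r : M → ℕ} {a b : M}
    (h : r a < r b) : (PrefList.ofRank r).prefers a b :=
  Prod.Lex.toLex_lt_toLex.2 (Or.inl h)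

/-- The roles of the women, and also those of the men. For women, `inl i`, `inr (inl j)` and
`inr (inr l)` stand for `aᵢ`, `b'ⱼ` and `c_l`; for men, they stand for `a'ᵢ`, `bⱼ` and `d_l`. With
this choice the marriage for disjoint sets is the identity. -/
abbrev Role (m k : ℕ) : Type := Fin m ⊕ Fin m ⊕ Fin (k + 1)

variable {m k : ℕ}

/-- `womanRank x w v` is the rank of the man `v` on the list of the woman `w`, where Alice's set is
`x`; lower is better. The lists are `aᵢ : {bⱼ | (i, j) ∈ x}, a'ᵢ, …`; `b'ⱼ : bⱼ, d₀, …`;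
`c_l : d_l, d_{l+1}, …`. -/
def womanRank (x : Finset (Fin m × Fin m)) : Role m k → Role m k → ℕ
  | .inl i, .inl i' => if i' = i then 1 else 2
  | .inl i, .inr (.inl j) => if (i, j) ∈ x then 0 else 2
  | .inl _, .inr (.inr _) => 2
  | .inr (.inl _), .inl _ => 2
  | .inr (.inl j), .inr (.inl j') => if j' = j then 0 else 2
  | .inr (.inl _), .inr (.inr l) => if l = 0 then 1 else 2
  | .inr (.inr _), .inl _ => 2
  | .inr (.inr _), .inr (.inl _) => 2
  | .inr (.inr l), .inr (.inr l') => if l' = l then 0 else if l'.val = l.val + 1 then 1 else 2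

/-- `manRank y v w` is the rank of the woman `w` on the list of the man `v`, where Bob's set is `y`;
lower is better. The lists are `a'ᵢ : aᵢ, …`; `bⱼ : {aᵢ | (i, j) ∈ y}, b'ⱼ, …`;
`d₀ : {b'ⱼ}, c₀, …`; `d_{l+1} : c_l, c_{l+1}, …`. -/
def manRank (y : Finset (Fin m × Fin m)) : Role m k → Role m k → ℕ
  | .inl i, .inl i' => if i' = i then 0 else 1
  | .inl _, .inr _ => 1
  | .inr (.inl j), .inl i => if (i, j) ∈ y then 0 else 2
  | .inr (.inl j), .inr (.inl j') => if j' = j then 1 else 2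
  | .inr (.inl _), .inr (.inr _) => 2
  | .inr (.inr _), .inl _ => 2
  | .inr (.inr l), .inr (.inl _) => if l = 0 then 0 else 2
  | .inr (.inr l), .inr (.inr l') => if l'.val + 1 = l.val then 0 else if l' = l then 1 else 2

/-- The marriage `ν` has no blocking pair whose members gain strictly in rank. Stability under any
tie-breaking implies this, so ties need no further attention. -/
def IsRankStable (x y : Finset (Fin m × Fin m)) (ν : Role m k ≃ Role m k) : Prop :=
  ∀ w v, womanRank x w v < womanRank x w (ν w) → manRank y v (ν.symm v) ≤ manRank y v w

namespace IsRankStable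

variable {x y : Finset (Fin m × Fin m)} {ν : Role m k ≃ Role m k}

/-- `a'ᵢ` ranks `aᵢ` first, so `aᵢ` gets `a'ᵢ` or a man she ranks higher. -/
theorem apply_inl (h : IsRankStable x y ν) (i : Fin m) :
    ν (.inl i) = .inl i ∨ ∃ j, (i, j) ∈ x ∧ ν (.inl i) = .inr (.inl j) := by
  have hb := h (.inl i) (.inl i)
  have hs : ν.symm (.inl i) = .inl i → ν (.inl i) = .inl i := fun e => by
    rw [← e, ν.apply_symm_apply, e]
  rcases hv : ν (.inl i) with i' | j | l <;> rcases hw : ν.symm (.inl i) with i'' | w <;>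
    simp only [hv, hw, womanRank, manRank] at hb hs ⊢ <;> grind

/-- `b'ⱼ` ranks `bⱼ` first, so `bⱼ` gets `b'ⱼ` or a woman he ranks higher. -/
theorem symm_apply_inr_inl (h : IsRankStable x y ν) (j : Fin m) :
    ν.symm (.inr (.inl j)) = .inr (.inl j) ∨
      ∃ i, (i, j) ∈ y ∧ ν.symm (.inr (.inl j)) = .inl i := by
  have hb := h (.inr (.inl j)) (.inr (.inl j))
  have hs : ν (.inr (.inl j)) = .inr (.inl j) → ν.symm (.inr (.inl j)) = .inr (.inl j) :=
    fun e => by rw [← e, ν.symm_apply_apply, e]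
  rcases hv : ν (.inr (.inl j)) with i' | j' | l <;>
    rcases hw : ν.symm (.inr (.inl j)) with i'' | j'' | l'' <;>
    simp only [hv, hw, womanRank, manRank] at hb hs ⊢ <;> grind

theorem mem_inter_of_apply_eq (h : IsRankStable x y ν) {i j : Fin m}
    (hij : ν (.inl i) = .inr (.inl j)) : (i, j) ∈ x ∩ y := by
  have hs : ν.symm (.inr (.inl j)) = .inl i := by rw [← hij, ν.symm_apply_apply]
  rw [mem_inter]
  constructor
  · rcases h.apply_inl i with e | ⟨j', hj', e⟩
    · simp [e] at hij
    · rw [e] at hij; simp at hij; rwa [← hij]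
  · rcases h.symm_apply_inr_inl j with e | ⟨i', hi', e⟩
    · simp [e] at hs
    · rw [e] at hs; simp at hs; rwa [← hs]

/-- For disjoint sets nobody leaves the reserve, no `b'ⱼ` reaches `d₀`, and along the chain each
`d_l` is, inductively, left with `c_l`, who ranks him first. -/
theorem apply_chain_of_disjoint (h : IsRankStable x y ν) (hxy : Disjoint x y)
    (l : Fin (k + 1)) : ν (.inr (.inr l)) = .inr (.inr l) := by
  rw [disjoint_iff_inter_eq_empty] at hxy
  have hA : ∀ i, ν (.inl i) = .inl i := fun i => by
    rcases h.apply_inl i with e | ⟨j, _, e⟩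
    · exact e
    · simpa [hxy] using h.mem_inter_of_apply_eq e
  have hB : ∀ j, ν (.inr (.inl j)) = .inr (.inl j) := fun j => by
    rcases h.symm_apply_inr_inl j with e | ⟨i, _, e⟩
    · rw [Equiv.symm_apply_eq] at e; exact e.symm
    · rw [Equiv.symm_apply_eq, hA] at e; simp at e
  induction l using WellFoundedLT.induction with
  | ind l ih =>
    by_contra hne
    have hb := h (.inr (.inr l)) (.inr (.inr l))
    have h1 : womanRank x (.inr (.inr l)) (.inr (.inr l)) <
        womanRank x (.inr (.inr l)) (ν (.inr (.inr l))) := by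
      rcases hv : ν (.inr (.inr l)) with i | j | l'
      · simp [womanRank]
      · simp [womanRank]
      · have : l' ≠ l := by rintro rfl; exact hne hv
        simp only [womanRank, if_true, if_neg this]
        split_ifs <;> norm_num
    have hb := hb h1
    rcases hw : ν.symm (.inr (.inr l)) with i | j | l'
    · rw [Equiv.symm_apply_eq, hA] at hw; simp at hw
    · rw [Equiv.symm_apply_eq, hB] at hw; simp at hw
    · have hw' := (Equiv.symm_apply_eq _).1 hw
      have h2 : l' ≠ l := by rintro rfl; exact hne hw'.symm
      have h3 : ¬ l'.val + 1 = l.val := by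
        intro e
        have := ih l' (Fin.lt_def.2 (by omega))
        rw [← hw'] at this
        simp at this
        exact h2 this.symm
      simp [hw, manRank, h2, h3] at hb

theorem apply_eq_of_inter_eq (h : IsRankStable x y ν) {i j : Fin m}
    (hxy : x ∩ y = {(i, j)}) : ν (.inl i) = .inr (.inl j) := by
  have hmem : (i, j) ∈ x ∩ y := by simp [hxy]
  rw [mem_inter] at hmem
  by_contra hne
  have hi : ν (.inl i) = .inl i := by
    rcases h.apply_inl i with e | ⟨j', _, e⟩
    · exact e
    · have := h.mem_inter_of_apply_eq e
      simp [hxy] at this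
      exact absurd (this ▸ e) hne
  have hj : ν.symm (.inr (.inl j)) = .inr (.inl j) := by
    rcases h.symm_apply_inr_inl j with e | ⟨i', _, e⟩
    · exact e
    · have e' := ((Equiv.symm_apply_eq _).1 e).symm
      have := h.mem_inter_of_apply_eq e'
      simp [hxy] at this
      exact absurd (this ▸ e') hne
  have hb := h (.inl i) (.inr (.inl j))
  simp [hi, hj, womanRank, manRank, hmem.1, hmem.2] at hb

/-- The woman `b'ⱼ`, having lost `bⱼ`, marries `d₀`: the other women whom `d₀` ranks as high are
with their first choices. -/
theorem apply_released_of_inter_eq (h : IsRankStable x y ν) {i j : Fin m}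
    (hxy : x ∩ y = {(i, j)}) : ν (.inr (.inl j)) = .inr (.inr 0) := by
  have hij := h.apply_eq_of_inter_eq hxy
  have hother : ∀ j', j' ≠ j → ν (.inr (.inl j')) = .inr (.inl j') := fun j' hj' => by
    rcases h.symm_apply_inr_inl j' with e | ⟨i', _, e⟩
    · exact ((Equiv.symm_apply_eq _).1 e).symm
    · have := h.mem_inter_of_apply_eq ((Equiv.symm_apply_eq _).1 e).symm
      simp [hxy] at this
      exact absurd this.2 hj'
  by_contra hne
  have h1 : womanRank x (.inr (.inl j)) (.inr (.inr 0) : Role m k) <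
      womanRank x (.inr (.inl j)) (ν (.inr (.inl j))) := by
    rcases hv : ν (.inr (.inl j)) with i' | j' | l
    · simp [womanRank]
    · have : j' ≠ j := by
        rintro rfl
        have := ν.injective (hij.trans hv.symm)
        simp at this
      simp [womanRank, this]
    · have : l ≠ 0 := by rintro rfl; exact hne hv
      simp [womanRank, this]
  have hb := h _ _ h1
  rcases hw : ν.symm (.inr (.inr 0)) with i' | j' | l
  · simp [hw, manRank] at hb
  · have hw' := (Equiv.symm_apply_eq _).1 hw
    by_cases hj' : j' = j
    · exact hne (hj' ▸ hw'.symm)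
    · rw [hother j' hj'] at hw'; simp at hw'
  · simp only [hw, manRank] at hb
    grind

/-- With exactly one common point the whole chain is shifted: `c_l` finds `d_l` taken by the
preceding woman and marries `d_{l+1}`, who ranks her first. -/
theorem apply_chain_of_inter_eq (h : IsRankStable x y ν) {i j : Fin m}
    (hxy : x ∩ y = {(i, j)}) (l : Fin k) :
    ν (.inr (.inr l.castSucc)) = .inr (.inr l.succ) := by
  have hrel := h.apply_released_of_inter_eq hxy
  induction l using WellFoundedLT.induction with
  | ind l ih =>
    have htaken : ν (.inr (.inr l.castSucc)) ≠ .inr (.inr l.castSucc) := by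
      intro e
      by_cases hl : l.val = 0
      · have h0 : l.castSucc = 0 := Fin.ext (by simp [hl])
        rw [h0] at e
        have := ν.injective (e.trans hrel.symm)
        simp at this
      · have hp : l.val - 1 < k := by omega
        have h1 := ih ⟨l.val - 1, hp⟩ (Fin.lt_def.2 (by simp; omega))
        have h2 : (⟨l.val - 1, hp⟩ : Fin k).succ = l.castSucc := Fin.ext (by simp; omega)
        rw [h2] at h1
        have := ν.injective (h1.trans e.symm)
        simp [Fin.ext_iff] at this
        omega
    by_contra hne
    have h1 : womanRank x (.inr (.inr l.castSucc)) (.inr (.inr l.succ)) <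
        womanRank x (.inr (.inr l.castSucc)) (ν (.inr (.inr l.castSucc))) := by
      have h0 : womanRank x (.inr (.inr l.castSucc)) (.inr (.inr l.succ) : Role m k) = 1 := by
        simp [womanRank, Fin.ext_iff]
      rw [h0]
      rcases hv : ν (.inr (.inr l.castSucc)) with i' | j' | l'
      · simp [womanRank]
      · simp [womanRank]
      · have a1 : l' ≠ l.castSucc := by rintro rfl; exact htaken hv
        have a2 : ¬ l'.val = l.val + 1 := fun e => by
          have : l' = l.succ := Fin.ext (by simpa using e)
          exact hne (this ▸ hv)
        simp [womanRank, a1, a2]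
    have hb := h _ _ h1
    rcases hw : ν.symm (.inr (.inr l.succ)) with i' | j' | l'
    · simp [hw, manRank] at hb
    · simp [hw, manRank] at hb
    · have hw' := (Equiv.symm_apply_eq _).1 hw
      have a1 : ¬ l'.val = l.val := fun e => by
        have : l' = l.castSucc := Fin.ext (by simpa using e)
        exact hne (this ▸ hw'.symm)
      simp only [hw, manRank, Fin.val_succ, Fin.val_castSucc] at hb
      grind

end IsRankStable

theorem card_ne_le_divorceDist {W M : Type} [Fintype W] [DecidableEq M] (μ μ' : Marriage W M) :
    #{w | μ w ≠ μ' w} ≤ divorceDist μ μ' := by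
  have h1 : couples μ ∩ couples μ' ⊆
      (fun w => (w, μ w)) '' ((({w | μ w = μ' w} : Finset W) : Set W)) := by
    rintro ⟨w, v⟩ ⟨h, h'⟩
    simp only [couples, Set.mem_ofPred_eq] at h h'
    exact ⟨w, by simp [h, h'], by simp [h]⟩
  have h2 := (Set.ncard_le_ncard h1).trans (Set.ncard_image_le)
  rw [Set.ncard_coe_finset] at h2
  have h3 : #{w | μ w = μ' w} + #{w | μ w ≠ μ' w} = #(univ : Finset W) :=
    card_filter_add_card_filter_not _
  rw [divorceDist, Nat.card_eq_fintype_card, ← card_univ]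
  omega

/-- The women's profile that encodes Alice's set `x`, with roles assigned by `e`. -/
def womenProfile {n : ℕ} (e : Role m k ≃ Fin n) (x : Finset (Fin m × Fin m)) :
    Profile (Fin n) (Fin n) :=
  fun w => PrefList.ofRank fun v => womanRank x (e.symm w) (e.symm v)

/-- The men's profile that encodes Bob's set `y`, with roles assigned by `e`. -/
def menProfile {n : ℕ} (e : Role m k ≃ Fin n) (y : Finset (Fin m × Fin m)) :
    Profile (Fin n) (Fin n) :=
  fun v => PrefList.ofRank fun w => manRank y (e.symm v) (e.symm w)

theorem IsStable.isRankStable {n : ℕ} {e : Role m k ≃ Fin n} {x y : Finset (Fin m × Fin m)}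
    {μ : Marriage (Fin n) (Fin n)} (h : IsStable (womenProfile e x) (menProfile e y) μ) :
    IsRankStable x y ((e.trans μ).trans e.symm) := by
  intro w v hwv
  by_contra! hlt
  refine h (e w) (e v) ⟨PrefList.ofRank_prefers_of_lt ?_, PrefList.ofRank_prefers_of_lt ?_⟩
  · simpa using hwv
  · simpa using hlt

/-- The marriages that differ from `c_l – d_l` in at most `ε n` couples of the chain. The last woman
of the chain is left out, as there is no later man to whom she could be shifted. -/
def mostlyUnshifted {n : ℕ} (e : Role m k ≃ Fin n) (ε : ℝ) : Set (Marriage (Fin n) (Fin n)) :=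
  {μ | (#{l : Fin k | μ (e (.inr (.inr l.castSucc))) ≠ e (.inr (.inr l.castSucc))} : ℝ) ≤ ε * n}

theorem card_le_of_dist_le {n : ℕ} (e : Role m k ≃ Fin n) {ε : ℝ}
    {μ μ' : Marriage (Fin n) (Fin n)}
    (hd : (divorceDist μ μ' : ℝ) ≤ ε * (Nat.card (Fin n) : ℝ)) (A : Finset (Fin k))
    (hA : ∀ l ∈ A, μ (e (.inr (.inr l.castSucc))) ≠ μ' (e (.inr (.inr l.castSucc)))) :
    (#A : ℝ) ≤ ε * n := by
  rw [Nat.card_eq_fintype_card, Fintype.card_fin] at hd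
  refine le_trans ?_ hd
  have : #A ≤ #{w | μ w ≠ μ' w} := by
    refine card_le_card_of_injOn (fun l => e (.inr (.inr l.castSucc))) (fun l hl => ?_) ?_
    · simpa using hA l hl
    · intro a _ b _ hab
      simpa using hab
  exact_mod_cast this.trans (card_ne_le_divorceDist μ μ')

theorem mem_mostlyUnshifted_of_disjoint {n : ℕ} (e : Role m k ≃ Fin n) {ε : ℝ}
    {x y : Finset (Fin m × Fin m)} (hxy : Disjoint x y) {μ : Marriage (Fin n) (Fin n)}
    (h : FindApproxStable ε n (womenProfile e x) (menProfile e y) μ) :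
    μ ∈ mostlyUnshifted e ε := by
  obtain ⟨μ', hst, hd⟩ := h
  refine card_le_of_dist_le e hd _ fun l hl => ?_
  have := hst.isRankStable.apply_chain_of_disjoint hxy l.castSucc
  have : μ' (e (.inr (.inr l.castSucc))) = e (.inr (.inr l.castSucc)) := by
    simpa [Equiv.symm_apply_eq] using this
  rw [this]
  exact (mem_filter.1 hl).2

theorem notMem_mostlyUnshifted_of_inter_eq {n : ℕ} (e : Role m k ≃ Fin n) {ε : ℝ}
    (hk : 2 * ε * n < k) {x y : Finset (Fin m × Fin m)} {q : Fin m × Fin m}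
    (hxy : x ∩ y = {q}) {μ : Marriage (Fin n) (Fin n)}
    (h : FindApproxStable ε n (womenProfile e x) (menProfile e y) μ) :
    μ ∉ mostlyUnshifted e ε := by
  obtain ⟨μ', hst, hd⟩ := h
  intro hS
  simp only [mostlyUnshifted, Set.mem_ofPred_eq] at hS
  have h1 := card_le_of_dist_le e hd
    {l | ¬ μ (e (.inr (.inr l.castSucc))) ≠ e (.inr (.inr l.castSucc))} fun l hl => by
      have := hst.isRankStable.apply_chain_of_inter_eq (i := q.1) (j := q.2) hxy l
      have : μ' (e (.inr (.inr l.castSucc))) = e (.inr (.inr l.succ)) := by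
        simpa [Equiv.symm_apply_eq] using this
      rw [this, not_not.1 (mem_filter.1 hl).2]
      simp [Fin.ext_iff]
  have h2 := card_filter_add_card_filter_not (s := (univ : Finset (Fin k)))
    (fun l => μ (e (.inr (.inr l.castSucc))) ≠ e (.inr (.inr l.castSucc)))
  rw [card_univ, Fintype.card_fin] at h2
  have h3 : (k : ℝ) ≤ ε * n + ε * n := by
    rw [← h2, Nat.cast_add]
    exact add_le_add hS h1
  linarith

end Gadget

/-! ### Asymptotics -/

section Asymptotics

theorem randCommComplexity_findApproxStable_lower_bound {m k n : ℕ} (e : Role m k ≃ Fin n)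
    (hm : 0 < m) {ε : ℝ} (hk : 2 * ε * n < k) {p : ℝ} (hp : 1 / 2 < p) (hp' : p ≤ 1)
    {Q : RandProtocol (Profile (Fin n) (Fin n)) (Profile (Fin n) (Fin n))
      (Marriage (Fin n) (Fin n))}
    (hQ : Q.Solves p (FindApproxStable ε n)) {b : ℕ} (hb : Q.cost ≤ b) :
    ((2 * p - 1) / 24) ^ 3 / 2 * (m : ℝ) ^ 2 - Real.log (16 / (2 * p - 1)) ≤ b := by
  -- With this `η` the error term `12 η` is half of the advantage `2 p - 1`.
  set η : ℝ := (2 * p - 1) / 24 with hη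
  have : Nonempty (Fin m × Fin m) := ⟨(⟨0, hm⟩, ⟨0, hm⟩)⟩
  have h := RandProtocol.two_mul_le_of_separates (womenProfile e) (menProfile e)
    (mostlyUnshifted e ε) (fun x y hxy z hz => mem_mostlyUnshifted_of_disjoint e hxy hz)
    (fun x y q hxy z hz => notMem_mostlyUnshifted_of_inter_eq e hk hxy hz)
    (η := η) (by linarith) (by linarith) hQ hb
  have hcard : (Fintype.card (Fin m × Fin m) : ℝ) = (m : ℝ) ^ 2 := by simp [sq]
  rw [hcard] at h
  have hpos : 0 < 16 / (2 * p - 1) := by have : 0 < 2 * p - 1 := by linarith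
                                         positivity
  have h2 : (2 : ℝ) ^ b ≤ Real.exp b := by
    rw [← Real.exp_one_pow]
    gcongr
    linarith [Real.add_one_le_exp (1 : ℝ)]
  have h3 : 1 ≤ Real.exp (b - η ^ 3 / 2 * (m : ℝ) ^ 2 + Real.log (16 / (2 * p - 1))) := by
    rw [Real.exp_add, Real.exp_log hpos, sub_eq_add_neg, Real.exp_add, ← mul_div_assoc, one_le_div
      (by linarith)]
    have := mul_le_mul_of_nonneg_right h2 (Real.exp_pos (-(η ^ 3 / 2 * (m : ℝ) ^ 2))).le
    linarith
  rw [Real.one_le_exp_iff] at h3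
  linarith

theorem isOmegaSq_randCommComplexity {ε : ℝ} (hε₀ : 0 ≤ ε) (hε : ε < 1 / 2) {p : ℝ}
    (hp : 1 / 2 < p) (hp' : p ≤ 1) :
    IsOmegaSq fun n => randCommComplexity p (FindApproxStable ε n) := by
  -- With `m ≈ γ n` the `2 m` couples outside the chain leave it longer than `2 ε n`.
  set γ : ℝ := (1 - 2 * ε) / 4 with hγ
  set δ : ℝ := ((2 * p - 1) / 24) ^ 3 / 2 with hδ
  set C : ℝ := Real.log (16 / (2 * p - 1)) with hC
  have γ0 : 0 < γ := by linarith
  have δ0 : 0 < δ := by have : 0 < 2 * p - 1 := by linarith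
                        positivity
  have C0 : 0 ≤ C := Real.log_nonneg (by rw [one_le_div] <;> linarith)
  refine ⟨δ * γ ^ 2 / 8, by positivity, ⌈8 * C / (δ * γ ^ 2) + 2 / γ⌉₊, fun n hn => ?_⟩
  have hn := Nat.ceil_le.1 hn
  have hn1 : 8 * C / (δ * γ ^ 2) ≤ n := (le_add_of_nonneg_right (by positivity)).trans hn
  have hn2 : 2 / γ ≤ n := (le_add_of_nonneg_left (by positivity)).trans hn
  rw [div_le_iff₀ (by positivity)] at hn1 hn2
  have hγ4 : γ ≤ 1 / 4 := by linarith
  have hn8 : (8 : ℝ) ≤ n := by nlinarith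
  set m := ⌊γ * n⌋₊ with hm
  have m1 : (m : ℝ) ≤ γ * n := Nat.floor_le (by positivity)
  have m2 : γ * n - 1 < m := Nat.sub_one_lt_floor _
  have m3 : γ * n / 2 ≤ m := by linarith
  have m0 : 0 < m := by
    have : (0 : ℝ) < m := by linarith
    exact_mod_cast this
  have hmn : 2 * m + 1 ≤ n := by
    have : (2 * m + 1 : ℝ) ≤ n := by nlinarith
    exact_mod_cast this
  obtain ⟨k, hkn⟩ := Nat.exists_eq_add_of_le hmn
  have hk : 2 * ε * n < k := by
    have : (n : ℝ) = 2 * m + 1 + k := by exact_mod_cast hkn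
    nlinarith
  have e : Role m k ≃ Fin n := Fintype.equivFinOfCardEq (by simp; omega)
  beta_reduce
  by_cases htop : randCommComplexity p (FindApproxStable ε n) = ⊤
  · simp [htop]
  obtain ⟨b, hv⟩ := ENat.ne_top_iff_exists.1 htop
  have hlt : randCommComplexity p (FindApproxStable ε n) < ((b + 1 : ℕ) : ℕ∞) := by
    rw [← hv]; exact_mod_cast Nat.lt_succ_self b
  simp only [randCommComplexity, iInf_lt_iff] at hlt
  obtain ⟨Q, hQ, hcost⟩ := hlt
  have hcost : Q.cost ≤ b := by
    rw [Nat.cast_add, Nat.cast_one] at hcost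
    exact Order.lt_add_one_iff_of_not_isMax (by simp) |>.1 hcost
  have main := randCommComplexity_findApproxStable_lower_bound e m0 hk hp hp' hQ hcost
  rw [← hδ, ← hC] at main
  have hm2 : (γ * n / 2) ^ 2 ≤ (m : ℝ) ^ 2 := by gcongr
  have hCn : 8 * C ≤ n ^ 2 * (δ * γ ^ 2) := by
    refine hn1.trans ?_
    gcongr
    nlinarith
  have : δ * γ ^ 2 / 8 * (n : ℝ) ^ 2 ≤ b := by
    have := mul_le_mul_of_nonneg_left hm2 δ0.le
    linarith
  rw [← hv, ENat.toENNReal_coe, ← ENNReal.ofReal_natCast]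
  exact ENNReal.ofReal_le_ofReal this

/-- A correct deterministic protocol is a randomized one with success probability `1`. -/
theorem randCommComplexity_one_le_detCommComplexity {X Y Z : Type} (R : X → Y → Z → Prop) :
    randCommComplexity 1 R ≤ detCommComplexity R := by
  refine le_iInf₂ fun P hP => ?_
  refine (iInf₂_le (PMF.pure P) fun x y => ?_).trans ?_
  · rw [ENNReal.ofReal_one, PMF.toOuterMeasure_pure_apply, if_pos (Set.mem_ofPred_eq ▸ hP x y)]
  · refine iSup₂_le fun P' hP' => ?_
    rw [PMF.mem_support_pure_iff] at hP'
    rw [hP']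

end Asymptotics

theorem theorem2 (ε : ℝ) (hε₀ : 0 ≤ ε) (hε : ε < 1 / 2) :
    (∀ p : ℝ, 1 / 2 < p → p ≤ 1 →
      IsOmegaSq (fun n => randCommComplexity p (FindApproxStable ε n))) ∧
    IsOmegaSq (fun n => detCommComplexity (FindApproxStable ε n)) := by
  refine ⟨fun p hp hp' => isOmegaSq_randCommComplexity hε₀ hε hp hp', ?_⟩
  obtain ⟨c, hc, n₀, h⟩ := isOmegaSq_randCommComplexity hε₀ hε (p := 1) (by norm_num) le_rfl
  exact ⟨c, hc, n₀, fun n hn => (h n hn).trans <| ENat.toENNReal_le.2 <|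
    randCommComplexity_one_le_detCommComplexity _⟩
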